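/- Let $(\overline M,\overline\phi,\xi,\eta,\overline g)$ be an indefinite nearly cosymplectic manifold: $\overline g$ is a semi-Riemannian metric with Levi-Civita connection $\overline\nabla$; $\overline\phi$ is a smooth $(1,1)$-tensor field, $\xi$ a smooth vector field and $\eta$ a 1-form with $\overline\phi^2=-I+\eta\otimes\xi$, $\eta(\xi)=1$, $\eta\circ\overline\phi=0$, $\overline\phi\xi=0$, $\overline g(\overline\phi X,\overline\phi Y)=\overline g(X,Y)-\eta(X)\eta(Y)$, $\eta=\overline g(\xi,\cdot)$; and $(\overline\nabla_X\overline\phi)Y+(\overline\nabla_Y\overline\phi)X=0$ for all vector fields $X,Y$. Let $(M,g,S(TM),S(TM^\perp))$ be a null (immersed) submanifold of $\overline M$: $\mathrm{Rad}\,TM=TM\cap TM^\perp$ is a nonzero smooth subbundle, $S(TM)$ and $S(TM^\perp)$ are nondegenerate smooth complements of $\mathrm{Rad}\,TM$ in $TM$ and in $TM^\perp$, and $l\mathrm{tr}(TM)$ is an associated null transversal bundle, i.e. an isotropic smooth subbundle of $T\overline M|_M$, orthogonal to $S(TM)$ and $S(TM^\perp)$, with $T\overline M|_M=TM\oplus \mathrm{tr}(TM)$,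 $\mathrm{tr}(TM)=l\mathrm{tr}(TM)\oplus S(TM^\perp)$. For $X,Y\in\Gamma(TM)$ let $h(X,Y)$ be the $\mathrm{tr}(TM)$-component of $\overline\nabla_XY$. Suppose that $M$ is a QGCR-null submanifold: there are smooth subbundles $D_1,D_2$ of $\mathrm{Rad}\,TM$, $D_0$ of $S(TM)$, $\mathcal L$ of $l\mathrm{tr}(TM)$ and $\mathcal S$ of $S(TM^\perp)$ such that $\mathrm{Rad}\,TM=D_1\oplus D_2$, $\overline\phi D_1=D_1$, $\overline\phi D_2\subset S(TM)$, $\overline D:=\overline\phi\mathcal S\oplus\overline\phi\mathcal L$ is a smooth subbundle, $S(TM)=\{\overline\phi D_2+\overline D\}\perp D_0$ (the sum $\overline\phi D_2+\overline D$ need not be direct), $\overline\phi D_0\subseteq D_0$, and $D_0$ is nondegenerate. Put $D=D_0\perp D_1$ and $\widehat D=D_2+\overline\phi D_2+\overline D$. Suppose that $M$ is proper ($D_1,D_0,D_2,\mathcal S$ are all nonzero), ascreen ($\xi\in\mathrm{Rad}\,TM\oplus l\mathrm{tr}(TM)$ along $M$) and mixed totally geodesic ($h(X,Y)=0$ for all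 $X\in\Gamma(D)$, $Y\in\Gamma(\widehat D)$). Let $U\subseteq M$ be open, let $E_1,\dots,E_r$ be a smooth frame of $\mathrm{Rad}\,TM$ over $U$, $N_1,\dots,N_r$ the dual frame of $l\mathrm{tr}(TM)$ ($\overline g(E_i,N_j)=\delta_{ij}$) and $(W_\alpha)$ a smooth orthogonal frame of $S(TM^\perp)$ over $U$. Let $h_k^l(X,Y)$ be the $N_k$-component of $\overline\nabla_XY$, and $\varphi_{\alpha i}(X)$ the $N_i$-component of $\overline\nabla_XW_\alpha$, with respect to $T\overline M|_M=TM\oplus\mathrm{tr}(TM)$. Then, for every $X\in\Gamma(D|_U)$ and every $i$ with $E_i\in\Gamma(D_2|_U)$, one has on $U$ $$h_k^l(X,E_i)=0\ \text{ for all } k\in\{1,\dots,r\}\ (\text{in particular } h_i^l(X,E_i)=0),\qquad \varphi_{\alpha i}(X)=0\ \text{ for all }\alpha .$$ -/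

import Mathlib

open scoped Manifold ContDiff Topology

noncomputable section

namespace NullGeometry

section Ambient

variable {F : Type*} [NormedAddCommGroup F] [NormedSpace ℝ F]
  {Mb : Type*} [TopologicalSpace Mb] [ChartedSpace F Mb] [IsManifold 𝓘(ℝ, F) ∞ Mb]

variable (F Mb) in
/-- A semi-Riemannian metric: a smooth, symmetric, nondegenerate `(0,2)`-tensor field of constant
index. -/
structure SemiRiemannianMetric where
  /-- the scalar product on the tangent spaces -/
  val (p : Mb) : TangentSpace 𝓘(ℝ, F) p →L[ℝ] TangentSpace 𝓘(ℝ, F) p →L[ℝ] ℝ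
  symm (p : Mb) (v w : TangentSpace 𝓘(ℝ, F) p) : val p v w = val p w v
  nondegenerate (p : Mb) (v : TangentSpace 𝓘(ℝ, F) p) (hv : ∀ w, val p v w = 0) : v = 0
  /-- the index, i.e. the number of negative squares -/
  index : ℕ
  index_spec (p : Mb) : ∃ Vneg Vpos : Submodule ℝ (TangentSpace 𝓘(ℝ, F) p),
    IsCompl Vneg Vpos ∧ Module.finrank ℝ Vneg = index ∧
    (∀ v ∈ Vneg, v ≠ 0 → val p v v < 0) ∧ (∀ v ∈ Vpos, v ≠ 0 → 0 < val p v v)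
  contMDiff : ContMDiff 𝓘(ℝ, F) (𝓘(ℝ, F).prod 𝓘(ℝ, F →L[ℝ] F →L[ℝ] ℝ)) ∞
    (fun p ↦ Bundle.TotalSpace.mk' (F →L[ℝ] F →L[ℝ] ℝ)
      (E := fun p : Mb ↦ TangentSpace 𝓘(ℝ, F) p →L[ℝ] TangentSpace 𝓘(ℝ, F) p →L[ℝ] ℝ) p (val p))

/-- `cov` is the Levi-Civita connection of `g`: it is torsion-free and compatible with `g`.
(`cov Y p (X p)` is the value of `∇_X Y` at `p`.) -/
structure IsLeviCivita [FiniteDimensional ℝ F] (g : SemiRiemannianMetric F Mb)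
    (cov : CovariantDerivative 𝓘(ℝ, F) F (TangentSpace 𝓘(ℝ, F) : Mb → Type _)) : Prop where
  torsion_free : cov.torsion = 0
  metric (Y Z : Π p : Mb, TangentSpace 𝓘(ℝ, F) p) (p : Mb)
    (hY : MDiffAt (T% Y) p) (hZ : MDiffAt (T% Z) p) (v : TangentSpace 𝓘(ℝ, F) p) :
    mvfderiv 𝓘(ℝ, F) (fun q ↦ g.val q (Y q) (Z q)) p v
      = g.val p (cov Y p v) (Z p) + g.val p (Y p) (cov Z p v)

/-- An indefinite almost contact metric structure `(φ, ξ, η)` on `(Mb, g)`.  (The 1-form `η` is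
smooth because `η = g(ξ, ·)`.) -/
structure AlmostContactMetricStructure (g : SemiRiemannianMetric F Mb) where
  phi (p : Mb) : TangentSpace 𝓘(ℝ, F) p →L[ℝ] TangentSpace 𝓘(ℝ, F) p
  xi (p : Mb) : TangentSpace 𝓘(ℝ, F) p
  eta (p : Mb) : TangentSpace 𝓘(ℝ, F) p →L[ℝ] ℝ
  phi_smooth : ContMDiff 𝓘(ℝ, F) (𝓘(ℝ, F).prod 𝓘(ℝ, F →L[ℝ] F)) ∞
    (fun p ↦ Bundle.TotalSpace.mk' (F →L[ℝ] F)
      (E := fun p : Mb ↦ TangentSpace 𝓘(ℝ, F) p →L[ℝ] TangentSpace 𝓘(ℝ, F) p) p (phi p))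
  xi_smooth : ContMDiff 𝓘(ℝ, F) (𝓘(ℝ, F).prod 𝓘(ℝ, F)) ∞
    (fun p ↦ (⟨p, xi p⟩ : TangentBundle 𝓘(ℝ, F) Mb))
  phi_phi (p : Mb) (v : TangentSpace 𝓘(ℝ, F) p) : phi p (phi p v) = -v + eta p v • xi p
  eta_xi (p : Mb) : eta p (xi p) = 1
  eta_phi (p : Mb) (v : TangentSpace 𝓘(ℝ, F) p) : eta p (phi p v) = 0
  phi_xi (p : Mb) : phi p (xi p) = 0
  compatible (p : Mb) (v w : TangentSpace 𝓘(ℝ, F) p) :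
    g.val p (phi p v) (phi p w) = g.val p v w - eta p v * eta p w
  eta_eq (p : Mb) (v : TangentSpace 𝓘(ℝ, F) p) : eta p v = g.val p (xi p) v

/-- Nearly cosymplectic: `(∇_X φ) Y + (∇_Y φ) X = 0` for all smooth vector fields `X`, `Y`,
where `(∇_X φ) Y = ∇_X (φ Y) - φ (∇_X Y)`. -/
def AlmostContactMetricStructure.IsNearlyCosymplectic {g : SemiRiemannianMetric F Mb}
    (C : AlmostContactMetricStructure g)
    (cov : CovariantDerivative 𝓘(ℝ, F) F (TangentSpace 𝓘(ℝ, F) : Mb → Type _)) : Prop :=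
  ∀ X Y : Π p : Mb, TangentSpace 𝓘(ℝ, F) p,
    ContMDiff 𝓘(ℝ, F) (𝓘(ℝ, F).prod 𝓘(ℝ, F)) ∞
      (fun p ↦ (⟨p, X p⟩ : TangentBundle 𝓘(ℝ, F) Mb)) →
    ContMDiff 𝓘(ℝ, F) (𝓘(ℝ, F).prod 𝓘(ℝ, F)) ∞
      (fun p ↦ (⟨p, Y p⟩ : TangentBundle 𝓘(ℝ, F) Mb)) →
    ∀ p : Mb,
      (cov (fun q ↦ C.phi q (Y q)) p (X p) - C.phi p (cov Y p (X p)))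
        + (cov (fun q ↦ C.phi q (X q)) p (Y p) - C.phi p (cov X p (Y p))) = 0

end Ambient

section Submanifold

variable {E : Type*} [NormedAddCommGroup E] [NormedSpace ℝ E]
  {F : Type*} [NormedAddCommGroup F] [NormedSpace ℝ F]
  {M : Type*} [TopologicalSpace M] [ChartedSpace E M] [IsManifold 𝓘(ℝ, E) ∞ M]
  {Mb : Type*} [TopologicalSpace Mb] [ChartedSpace F Mb] [IsManifold 𝓘(ℝ, F) ∞ Mb]

/-- Vector fields along `f : M → Mb`: (not necessarily smooth) sections of `f^* T Mb`. -/
abbrev FieldAlong (F : Type*) [NormedAddCommGroup F] [NormedSpace ℝ F] {M : Type*} {Mb : Type*}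
    [TopologicalSpace Mb] [ChartedSpace F Mb] (f : M → Mb) : Type _ :=
  Π p : M, TangentSpace 𝓘(ℝ, F) (f p)

/-- Families of subspaces of the fibres of `f^* T Mb`. -/
abbrev SubspacesAlong (F : Type*) [NormedAddCommGroup F] [NormedSpace ℝ F] {M : Type*} {Mb : Type*}
    [TopologicalSpace Mb] [ChartedSpace F Mb] (f : M → Mb) : Type _ :=
  Π p : M, Submodule ℝ (TangentSpace 𝓘(ℝ, F) (f p))

variable (E) in
/-- The vector field `Y` along `f` is smooth on `U`. -/
def SmoothAlongOn (f : M → Mb) (Y : FieldAlong F f) (U : Set M) : Prop :=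
  ContMDiffOn 𝓘(ℝ, E) (𝓘(ℝ, F).prod 𝓘(ℝ, F)) ∞
    (fun p ↦ (⟨f p, Y p⟩ : TangentBundle 𝓘(ℝ, F) Mb)) U

variable (E) in
/-- `V` is a smooth vector subbundle (of constant rank) of `f^* T Mb`: near every point it has a
smooth local frame. -/
def IsSubbundle (f : M → Mb) (V : SubspacesAlong F f) : Prop :=
  ∃ k : ℕ, ∀ p : M, ∃ U : Set M, IsOpen U ∧ p ∈ U ∧ ∃ s : Fin k → FieldAlong F f,
    (∀ i, SmoothAlongOn E f (s i) U) ∧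
    ∀ q ∈ U, LinearIndependent ℝ (fun i ↦ s i q) ∧
      Submodule.span ℝ (Set.range (fun i ↦ s i q)) = V q

/-- The tangent bundle of the immersed manifold, as the subbundle `df(TM)` of `f^* T Mb`. -/
def tangentSub (f : M → Mb) : SubspacesAlong F f := fun p ↦
  LinearMap.range (mfderiv 𝓘(ℝ, E) 𝓘(ℝ, F) f p :
    TangentSpace 𝓘(ℝ, E) p →ₗ[ℝ] TangentSpace 𝓘(ℝ, F) (f p))

variable (F) in
/-- The vector field along `f` given by a vector field tangent to `M`. -/
def push (f : M → Mb) (X : Π p : M, TangentSpace 𝓘(ℝ, E) p) : FieldAlong F f := fun p ↦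
  mfderiv 𝓘(ℝ, E) 𝓘(ℝ, F) f p (X p)

/-- `X ∈ Γ(V|_U)` for a smooth vector field `X` of `M` and a subbundle `V` of `TM ≅ df(TM)`. -/
def IsTangentSection (f : M → Mb) (V : SubspacesAlong F f) (U : Set M)
    (X : Π p : M, TangentSpace 𝓘(ℝ, E) p) : Prop :=
  ContMDiffOn 𝓘(ℝ, E) (𝓘(ℝ, E).prod 𝓘(ℝ, E)) ∞
    (fun p ↦ (⟨p, X p⟩ : TangentBundle 𝓘(ℝ, E) M)) U ∧
  ∀ p ∈ U, push F f X p ∈ V p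

variable (E) in
/-- `Y ∈ Γ(V|_U)` for a field `Y` along `f` and a subbundle `V` of `f^* T Mb`. -/
def IsSectionAlong (f : M → Mb) (V : SubspacesAlong F f) (U : Set M) (Y : FieldAlong F f) : Prop :=
  SmoothAlongOn E f Y U ∧ ∀ p ∈ U, Y p ∈ V p

/-- The orthogonal complement of `V` with respect to `g`. -/
def perp (g : SemiRiemannianMetric F Mb) (f : M → Mb) (V : SubspacesAlong F f) :
    SubspacesAlong F f := fun p ↦
  { carrier := {v | ∀ w ∈ V p, g.val (f p) v w = 0}
    add_mem' := fun ha hb w hw ↦ by simp [ha w hw, hb w hw]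
    zero_mem' := fun w _ ↦ by simp
    smul_mem' := fun c a ha w hw ↦ by simp [ha w hw] }

/-- The radical distribution `Rad TM = TM ∩ TM^⊥`. -/
def radical (E : Type*) [NormedAddCommGroup E] [NormedSpace ℝ E] [ChartedSpace E M]
    (g : SemiRiemannianMetric F Mb) (f : M → Mb) : SubspacesAlong F f := fun p ↦
  tangentSub (E := E) f p ⊓ perp g f (tangentSub (E := E) f) p

/-- `g` is nondegenerate on `V`. -/
def NondegenerateOn (g : SemiRiemannianMetric F Mb) (f : M → Mb) (V : SubspacesAlong F f) : Prop :=
  ∀ p, ∀ v ∈ V p, (∀ w ∈ V p, g.val (f p) v w = 0) → v = 0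

/-- `V` and `W` are orthogonal. -/
def OrthogonalSub (g : SemiRiemannianMetric F Mb) (f : M → Mb) (V W : SubspacesAlong F f) : Prop :=
  ∀ p, ∀ v ∈ V p, ∀ w ∈ W p, g.val (f p) v w = 0

/-- The connection induced by `cov` on `f^* T Mb` (covariant derivative along `f`):
`∇_x Y = ∑ᵢ (x(Yⁱ) eᵢ + Yⁱ ∇_{df(x)} eᵢ)` where `Y = ∑ᵢ Yⁱ (eᵢ ∘ f)` and `(eᵢ)` is the local frame of
`T Mb` around `f p` given by the preferred trivialization at `f p`. -/
def covAlong [FiniteDimensional ℝ F]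
    (cov : CovariantDerivative 𝓘(ℝ, F) F (TangentSpace 𝓘(ℝ, F) : Mb → Type _))
    (f : M → Mb) (Y : FieldAlong F f) (p : M) (x : TangentSpace 𝓘(ℝ, E) p) :
    TangentSpace 𝓘(ℝ, F) (f p) :=
  let e := trivializationAt F (TangentSpace 𝓘(ℝ, F) : Mb → Type _) (f p)
  let b := Module.finBasis ℝ F
  ∑ i, (mvfderiv 𝓘(ℝ, E) (fun q ↦ e.localFrameCoeff 𝓘(ℝ, F) b i (f q) (Y q)) p x •
        e.localFrame b i (f p)
      + e.localFrameCoeff 𝓘(ℝ, F) b i (f p) (Y p) •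
          cov (e.localFrame b i) (f p) (mfderiv 𝓘(ℝ, E) 𝓘(ℝ, F) f p x))

/-- A null submanifold `(M, g, S(TM), S(TM^⊥))`, given by an immersion `f`, together with its null
transversal bundle `ltr(TM)`.  -/
structure NullSubmanifold (E : Type*) [NormedAddCommGroup E] [NormedSpace ℝ E] [ChartedSpace E M]
    (g : SemiRiemannianMetric F Mb) (f : M → Mb) where
  smooth : ContMDiff 𝓘(ℝ, E) 𝓘(ℝ, F) ∞ f
  immersion (p : M) : Function.Injective (mfderiv 𝓘(ℝ, E) 𝓘(ℝ, F) f p)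
  rad_subbundle : IsSubbundle E f (radical E g f)
  rad_ne_zero : radical E g f ≠ fun _ ↦ ⊥
  /-- the screen distribution `S(TM)` -/
  screen : SubspacesAlong F f
  screen_subbundle : IsSubbundle E f screen
  screen_nondegenerate : NondegenerateOn g f screen
  screen_disjoint (p : M) : Disjoint (radical E g f p) (screen p)
  screen_sup (p : M) : radical E g f p ⊔ screen p = tangentSub (E := E) f p
  /-- the screen transversal bundle `S(TM^⊥)` -/
  screenTr : SubspacesAlong F f
  screenTr_subbundle : IsSubbundle E f screenTr
  screenTr_nondegenerate : NondegenerateOn g f screenTr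
  screenTr_disjoint (p : M) : Disjoint (radical E g f p) (screenTr p)
  screenTr_sup (p : M) : radical E g f p ⊔ screenTr p = perp g f (tangentSub (E := E) f) p
  /-- the null transversal bundle `ltr(TM)` -/
  ltr : SubspacesAlong F f
  ltr_subbundle : IsSubbundle E f ltr
  ltr_isotropic : OrthogonalSub g f ltr ltr
  ltr_orth_screen : OrthogonalSub g f ltr screen
  ltr_orth_screenTr : OrthogonalSub g f ltr screenTr
  ltr_disjoint (p : M) : Disjoint (ltr p) (screenTr p)
  isCompl_tr (p : M) : IsCompl (tangentSub (E := E) f p) (ltr p ⊔ screenTr p)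

namespace NullSubmanifold

variable {g : SemiRiemannianMetric F Mb} {f : M → Mb}

/-- The transversal bundle `tr(TM) = ltr(TM) ⊥ S(TM^⊥)`. -/
def tr (S : NullSubmanifold E g f) : SubspacesAlong F f := fun p ↦ S.ltr p ⊔ S.screenTr p

/-- The projection of `T Mb = TM ⊕ tr(TM)` onto `tr(TM)` along `TM`. -/
def trProj (S : NullSubmanifold E g f) (p : M) : TangentSpace 𝓘(ℝ, F) (f p) →ₗ[ℝ] S.tr p :=
  (S.tr p).projectionOnto (tangentSub (E := E) f p) (S.isCompl_tr p).symm

/-- The second fundamental form `h(x, Y)`: the `tr(TM)`-component of `∇_x Y`. -/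
def secondFundamentalForm [FiniteDimensional ℝ F] (S : NullSubmanifold E g f)
    (cov : CovariantDerivative 𝓘(ℝ, F) F (TangentSpace 𝓘(ℝ, F) : Mb → Type _))
    (p : M) (x : TangentSpace 𝓘(ℝ, E) p) (Y : Π p : M, TangentSpace 𝓘(ℝ, E) p) : S.tr p :=
  S.trProj p (covAlong cov f (push F f Y) p x)

end NullSubmanifold

/-- A local quasi-orthonormal frame over `U`: a frame `E₁, …, E_r` of `Rad TM`, the dual null frame
`N₁, …, N_r` of `ltr(TM)` and an orthogonal frame `(W_α)` of `S(TM^⊥)`, with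
`ε_α = g(W_α, W_α)` not necessarily normalized to `±1`. -/
structure NullFrame {g : SemiRiemannianMetric F Mb} {f : M → Mb} (S : NullSubmanifold E g f)
    (U : Set M) (r s : ℕ) where
  Efr : Fin r → Π p : M, TangentSpace 𝓘(ℝ, E) p
  Nfr : Fin r → FieldAlong F f
  Wfr : Fin s → FieldAlong F f
  E_section (i : Fin r) : IsTangentSection f (radical E g f) U (Efr i)
  N_section (i : Fin r) : IsSectionAlong E f S.ltr U (Nfr i)
  W_section (α : Fin s) : IsSectionAlong E f S.screenTr U (Wfr α)
  E_linearIndependent (p : M) (hp : p ∈ U) : LinearIndependent ℝ (fun i ↦ push F f (Efr i) p)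
  E_span (p : M) (hp : p ∈ U) :
    Submodule.span ℝ (Set.range fun i ↦ push F f (Efr i) p) = radical E g f p
  N_linearIndependent (p : M) (hp : p ∈ U) : LinearIndependent ℝ (fun i ↦ Nfr i p)
  N_span (p : M) (hp : p ∈ U) : Submodule.span ℝ (Set.range fun i ↦ Nfr i p) = S.ltr p
  dual (p : M) (hp : p ∈ U) (i j : Fin r) :
    g.val (f p) (push F f (Efr i) p) (Nfr j p) = if i = j then 1 else 0
  W_linearIndependent (p : M) (hp : p ∈ U) : LinearIndependent ℝ (fun α ↦ Wfr α p)
  W_span (p : M) (hp : p ∈ U) : Submodule.span ℝ (Set.range fun α ↦ Wfr α p) = S.screenTr p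
  W_orthogonal (p : M) (hp : p ∈ U) (α β : Fin s) (hαβ : α ≠ β) :
    g.val (f p) (Wfr α p) (Wfr β p) = 0

namespace NullFrame

variable {g : SemiRiemannianMetric F Mb} {f : M → Mb} {S : NullSubmanifold E g f}
  {U : Set M} {r s : ℕ}

theorem tr_linearIndependent (Φ : NullFrame S U r s) (p : M) (hp : p ∈ U) :
    LinearIndependent ℝ (Sum.elim (fun i ↦ Φ.Nfr i p) (fun α ↦ Φ.Wfr α p)) := by
  refine (Φ.N_linearIndependent p hp).sum_type (Φ.W_linearIndependent p hp) ?_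
  rw [Φ.N_span p hp, Φ.W_span p hp]
  exact S.ltr_disjoint p

theorem tr_span (Φ : NullFrame S U r s) (p : M) (hp : p ∈ U) :
    Submodule.span ℝ (Set.range (Sum.elim (fun i ↦ Φ.Nfr i p) (fun α ↦ Φ.Wfr α p))) = S.tr p := by
  rw [Set.Sum.elim_range, Submodule.span_union, Φ.N_span p hp, Φ.W_span p hp]
  rfl

/-- The components of `v ∈ T Mb` along `N₁, …, N_r` (index `Sum.inl i`) and along the `W_α`
(index `Sum.inr α`) in the decomposition `T Mb = TM ⊕ tr(TM)`. -/
def trCoord (Φ : NullFrame S U r s) (p : M) (hp : p ∈ U) (v : TangentSpace 𝓘(ℝ, F) (f p)) :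
    Fin r ⊕ Fin s → ℝ :=
  (Φ.tr_linearIndependent p hp).repr
    ⟨(S.trProj p v : TangentSpace 𝓘(ℝ, F) (f p)), by
      rw [Φ.tr_span p hp]; exact (S.trProj p v).2⟩

variable [FiniteDimensional ℝ F]

/-- The local null fundamental form `h_i^l(x, Y)`: the `N_i`-component of `∇_x Y`
(Gauss formula). -/
def hl (Φ : NullFrame S U r s)
    (cov : CovariantDerivative 𝓘(ℝ, F) F (TangentSpace 𝓘(ℝ, F) : Mb → Type _))
    (i : Fin r) (p : M) (hp : p ∈ U) (x : TangentSpace 𝓘(ℝ, E) p)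
    (Y : Π p : M, TangentSpace 𝓘(ℝ, E) p) : ℝ :=
  Φ.trCoord p hp (covAlong cov f (push F f Y) p x) (Sum.inl i)

/-- The 1-form `φ_{αi}(x)`: the `N_i`-component of `∇_x W_α` (Weingarten formula). -/
def varphi (Φ : NullFrame S U r s)
    (cov : CovariantDerivative 𝓘(ℝ, F) F (TangentSpace 𝓘(ℝ, F) : Mb → Type _))
    (α : Fin s) (i : Fin r) (p : M) (hp : p ∈ U) (x : TangentSpace 𝓘(ℝ, E) p) : ℝ :=
  Φ.trCoord p hp (covAlong cov f (Φ.Wfr α) p x) (Sum.inl i)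

end NullFrame

/-- The image `φ V` of `V` under the structure tensor `φ`. -/
def AlmostContactMetricStructure.image {g : SemiRiemannianMetric F Mb}
    (C : AlmostContactMetricStructure g) {f : M → Mb} (V : SubspacesAlong F f) :
    SubspacesAlong F f := fun p ↦
  (V p).map (C.phi (f p) : TangentSpace 𝓘(ℝ, F) (f p) →ₗ[ℝ] TangentSpace 𝓘(ℝ, F) (f p))

/-- The data of a quasi generalized CR (QGCR) null submanifold:
`Rad TM = D₁ ⊕ D₂`, `φ D₁ = D₁`, `φ D₂ ⊆ S(TM)`, `S(TM) = {φ D₂ + Dbar} ⊥ D₀`, `φ D₀ ⊆ D₀`,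
`Dbar = φ 𝒮 ⊕ φ ℒ`.  The sum `φ D₂ + Dbar` is not required to be direct: in the ascreen case
`φ ℒ` meets `φ D₂` nontrivially. -/
structure QGCRStructure {g : SemiRiemannianMetric F Mb} {f : M → Mb} (S : NullSubmanifold E g f)
    (C : AlmostContactMetricStructure g) where
  D₁ : SubspacesAlong F f
  D₂ : SubspacesAlong F f
  D₀ : SubspacesAlong F f
  /-- the subbundle `ℒ` of `ltr(TM)` -/
  calL : SubspacesAlong F f
  /-- the subbundle `𝒮` of `S(TM^⊥)` -/
  calS : SubspacesAlong F f
  D₁_subbundle : IsSubbundle E f D₁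
  D₂_subbundle : IsSubbundle E f D₂
  D₀_subbundle : IsSubbundle E f D₀
  calL_subbundle : IsSubbundle E f calL
  calS_subbundle : IsSubbundle E f calS
  Dbar_subbundle : IsSubbundle E f (fun p ↦ C.image calS p ⊔ C.image calL p)
  rad_disjoint (p : M) : Disjoint (D₁ p) (D₂ p)
  rad_sup (p : M) : D₁ p ⊔ D₂ p = radical E g f p
  phi_D₁ (p : M) : C.image D₁ p = D₁ p
  phi_D₂ (p : M) : C.image D₂ p ≤ S.screen p
  calL_le (p : M) : calL p ≤ S.ltr p
  calS_le (p : M) : calS p ≤ S.screenTr p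
  Dbar_disjoint (p : M) : Disjoint (C.image calS p) (C.image calL p)
  screen_eq (p : M) :
    S.screen p = (C.image D₂ p ⊔ (C.image calS p ⊔ C.image calL p)) ⊔ D₀ p
  screen_orth :
    OrthogonalSub g f (fun p ↦ C.image D₂ p ⊔ (C.image calS p ⊔ C.image calL p)) D₀
  phi_D₀ (p : M) : C.image D₀ p ≤ D₀ p
  D₀_nondegenerate : NondegenerateOn g f D₀

namespace QGCRStructure

variable {g : SemiRiemannianMetric F Mb} {f : M → Mb} {S : NullSubmanifold E g f}
  {C : AlmostContactMetricStructure g}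

/-- `Dbar = φ 𝒮 ⊕ φ ℒ`. -/
def Dbar (Q : QGCRStructure S C) : SubspacesAlong F f := fun p ↦
  C.image Q.calS p ⊔ C.image Q.calL p

/-- `D = D₀ ⊥ D₁`. -/
def D (Q : QGCRStructure S C) : SubspacesAlong F f := fun p ↦ Q.D₀ p ⊔ Q.D₁ p

/-- `Dhat = {D₂ ⊥ φ D₂} + Dbar`, the complement of `D` in `TM`. -/
def Dhat (Q : QGCRStructure S C) : SubspacesAlong F f := fun p ↦
  (Q.D₂ p ⊔ C.image Q.D₂ p) ⊔ Q.Dbar p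

/-- Proper: none of `D₁`, `D₀`, `D₂`, `𝒮` is the zero bundle. -/
def IsProper (Q : QGCRStructure S C) : Prop :=
  (Q.D₁ ≠ fun _ ↦ ⊥) ∧ (Q.D₀ ≠ fun _ ↦ ⊥) ∧ (Q.D₂ ≠ fun _ ↦ ⊥) ∧ (Q.calS ≠ fun _ ↦ ⊥)

/-- Mixed totally geodesic: `h(X, Y) = 0` for all `X ∈ Γ(D)` and `Y ∈ Γ(Dhat)`. -/
def IsMixedTotallyGeodesic [FiniteDimensional ℝ F] (Q : QGCRStructure S C)
    (cov : CovariantDerivative 𝓘(ℝ, F) F (TangentSpace 𝓘(ℝ, F) : Mb → Type _)) : Prop :=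
  ∀ X Y : Π p : M, TangentSpace 𝓘(ℝ, E) p,
    IsTangentSection f Q.D Set.univ X → IsTangentSection f Q.Dhat Set.univ Y →
    ∀ p, S.secondFundamentalForm cov p (X p) Y = 0

end QGCRStructure

/-- Ascreen: the structure vector field `ξ` belongs to `Rad TM ⊕ ltr(TM)` along `M`. -/
def NullSubmanifold.IsAscreen {g : SemiRiemannianMetric F Mb} {f : M → Mb}
    (S : NullSubmanifold E g f) (C : AlmostContactMetricStructure g) : Prop :=
  ∀ p, C.xi (f p) ∈ radical E g f p ⊔ S.ltr p

end Submanifold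

end NullGeometry

end

namespace NullGeometry

open Bundle

section

variable {E : Type*} [NormedAddCommGroup E] [NormedSpace ℝ E]
  {F : Type*} [NormedAddCommGroup F] [NormedSpace ℝ F]
  {M : Type*} [TopologicalSpace M] [ChartedSpace E M]
  {Mb : Type*} [TopologicalSpace Mb] [ChartedSpace F Mb]

/-! Since `D₂` lies in `Dhat`, mixed total geodesy gives `h(X, E_i) = 0`: the vector `∇_X E_i` is
tangent to `M`, so all its `N_k`-components vanish. For `φ_{αi}`, differentiate `g(E_i, W_α) = 0`
along `X`: `0 = g(∇_X E_i, W_α) + g(E_i, ∇_X W_α)`. The first term is zero because `∇_X E_i` is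
tangent and `W_α` is normal; the second is `φ_{αi}(X)`, because pairing with `E_i` reads off the
`N_i`-component. Three lemmas carry this: `IsTangentSection.exists_extension` (the geodesy
hypothesis concerns global fields, while `X` and `E_i` are local), `NullFrame.trCoord_inl`
(components as pairings) and `IsLeviCivita.mvfderiv_covAlong` (the Leibniz rule for fields along
`f`). -/

/-! ### Derivatives of real-valued functions -/

theorem mvfderiv_finset_sum {ι : Type*} (t : Finset ι) {φ : ι → M → ℝ} {p : M}
    (hφ : ∀ i ∈ t, MDifferentiableAt 𝓘(ℝ, E) 𝓘(ℝ, ℝ) (φ i) p) :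
    MDifferentiableAt 𝓘(ℝ, E) 𝓘(ℝ, ℝ) (fun q ↦ ∑ i ∈ t, φ i q) p ∧
      mvfderiv 𝓘(ℝ, E) (fun q ↦ ∑ i ∈ t, φ i q) p = ∑ i ∈ t, mvfderiv 𝓘(ℝ, E) (φ i) p := by
  classical
  induction t using Finset.induction_on with
  | empty => exact ⟨by simpa using mdifferentiableAt_const, by simp [mvfderiv_const]⟩
  | insert a t ha ih =>
    obtain ⟨h₁, h₂⟩ := ih fun i hi ↦ hφ i (Finset.mem_insert_of_mem hi)
    have h₃ := hφ a (Finset.mem_insert_self a t)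
    simp only [Finset.sum_insert ha]
    exact ⟨h₃.add h₁, by rw [← h₂]; exact mvfderiv_add h₃ h₁⟩

theorem mvfderiv_mul_mul {a b c : M → ℝ} {p : M} (ha : MDifferentiableAt 𝓘(ℝ, E) 𝓘(ℝ, ℝ) a p)
    (hb : MDifferentiableAt 𝓘(ℝ, E) 𝓘(ℝ, ℝ) b p) (hc : MDifferentiableAt 𝓘(ℝ, E) 𝓘(ℝ, ℝ) c p)
    (x : TangentSpace 𝓘(ℝ, E) p) :
    mvfderiv 𝓘(ℝ, E) (fun q ↦ a q * (b q * c q)) p x =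
      mvfderiv 𝓘(ℝ, E) a p x * (b p * c p) +
        a p * (mvfderiv 𝓘(ℝ, E) b p x * c p + b p * mvfderiv 𝓘(ℝ, E) c p x) := by
  have h : mvfderiv 𝓘(ℝ, E) (fun q ↦ a q * (b q * c q)) p = _ := mvfderiv_mul ha (hb.mul hc)
  rw [h, mvfderiv_fun_mul hb hc]
  simp only [add_apply, smul_apply, smul_eq_mul]
  ring

theorem mvfderiv_congr_of_eventuallyEq {a b : M → ℝ} {p : M} (h : a =ᶠ[𝓝 p] b) :
    mvfderiv 𝓘(ℝ, E) a p = mvfderiv 𝓘(ℝ, E) b p := by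
  ext x
  exact congr($(h.mfderiv_eq (I := 𝓘(ℝ, E)) (I' := 𝓘(ℝ, ℝ))) x)

/-! ### Tangent sections: extension and pushforward -/

/-- Multiply by a bump function supported in `U`; the fibres of `V` are subspaces, so membership
survives. Agreement near `p`, not only at `p`, is what allows the extension to be differentiated in
place of `X`. -/
theorem IsTangentSection.exists_extension [FiniteDimensional ℝ E] [T2Space M]
    [IsManifold 𝓘(ℝ, E) ∞ M] {f : M → Mb}
    {V : SubspacesAlong F f} {U : Set M} (hU : IsOpen U) {X : Π p : M, TangentSpace 𝓘(ℝ, E) p}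
    (hX : IsTangentSection f V U X) {p : M} (hp : p ∈ U) :
    ∃ X' : Π p : M, TangentSpace 𝓘(ℝ, E) p,
      IsTangentSection f V Set.univ X' ∧ ∀ᶠ q in 𝓝 p, X' q = X q := by
  obtain ⟨ψ, -, hψ⟩ :=
    (SmoothBumpFunction.nhds_basis_tsupport (I := 𝓘(ℝ, E)) p).mem_iff.1 (hU.mem_nhds hp)
  refine ⟨(ψ : M → ℝ) • X, ⟨contMDiffOn_univ.2 ?_, fun q _ ↦ ?_⟩, ?_⟩
  · exact ContMDiffOn.smul_section_of_tsupport ψ.contMDiff.contMDiffOn hU hψ hX.1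
  · have h : push F f ((ψ : M → ℝ) • X) q = ψ q • push F f X q := by simp [push]
    rw [h]
    by_cases hq : q ∈ U
    · exact (V q).smul_mem _ (hX.2 q hq)
    · rw [image_eq_zero_of_notMem_tsupport fun h ↦ hq (hψ h), zero_smul]
      exact (V q).zero_mem
  · filter_upwards [ψ.eventuallyEq_one] with q hq
    simp [hq]

variable [IsManifold 𝓘(ℝ, F) ∞ Mb]

theorem smoothAlongOn_push [IsManifold 𝓘(ℝ, E) ∞ M] {f : M → Mb}
    (hf : ContMDiff 𝓘(ℝ, E) 𝓘(ℝ, F) ∞ f) {U : Set M} {X : Π p : M, TangentSpace 𝓘(ℝ, E) p}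
    (hX : ContMDiffOn 𝓘(ℝ, E) (𝓘(ℝ, E).prod 𝓘(ℝ, E)) ∞
      (fun p ↦ (⟨p, X p⟩ : TangentBundle 𝓘(ℝ, E) M)) U) :
    SmoothAlongOn E f (push F f X) U :=
  (hf.contMDiff_tangentMap (m := ∞) le_rfl).comp_contMDiffOn hX

/-! ### Transversal components in a null frame -/

theorem NullFrame.trCoord_eq_zero [IsManifold 𝓘(ℝ, E) ∞ M]
    {g : SemiRiemannianMetric F Mb} {f : M → Mb}
    {S : NullSubmanifold E g f} {U : Set M} {r s : ℕ} (Φ : NullFrame S U r s) {p : M} (hp : p ∈ U)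
    {v : TangentSpace 𝓘(ℝ, F) (f p)} (hv : S.trProj p v = 0) : Φ.trCoord p hp v = 0 := by
  have h : (⟨(S.trProj p v : TangentSpace 𝓘(ℝ, F) (f p)), by
      rw [Φ.tr_span p hp]; exact (S.trProj p v).2⟩ : Submodule.span ℝ
        (Set.range (Sum.elim (fun i ↦ Φ.Nfr i p) (fun α ↦ Φ.Wfr α p)))) = 0 := by
    ext; simp [hv]
  unfold NullFrame.trCoord
  rw [h]
  simp

/-- `g(v, E_i)` is the `N_i`-component of `v`. -/
theorem NullFrame.trCoord_inl [IsManifold 𝓘(ℝ, E) ∞ M]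
    {g : SemiRiemannianMetric F Mb} {f : M → Mb}
    {S : NullSubmanifold E g f} {U : Set M} {r s : ℕ} (Φ : NullFrame S U r s) {p : M} (hp : p ∈ U)
    (v : TangentSpace 𝓘(ℝ, F) (f p)) (i : Fin r) :
    Φ.trCoord p hp v (Sum.inl i) = g.val (f p) (push F f (Φ.Efr i) p) v := by
  have hE : push F f (Φ.Efr i) p ∈ radical E g f p := (Φ.E_section i).2 p hp
  have hW (α : Fin s) : g.val (f p) (push F f (Φ.Efr i) p) (Φ.Wfr α p) = 0 := by
    have h : Φ.Wfr α p ∈ perp g f (tangentSub (E := E) f) p := by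
      rw [← S.screenTr_sup p]
      exact Submodule.mem_sup_right ((Φ.W_section α).2 p hp)
    rw [g.symm]
    exact h _ hE.1
  -- The tangential part of `v` is invisible to `E_i`, which is radical; only the transversal part
  -- contributes to the pairing.
  have hdec : v - (S.trProj p v : TangentSpace 𝓘(ℝ, F) (f p)) ∈ tangentSub (E := E) f p := by
    rw [← Submodule.projectionOnto_apply_eq_zero_iff (S.isCompl_tr p).symm, map_sub]
    exact sub_eq_zero.2 (Submodule.projectionOnto_apply_left _ _).symm
  have h₁ : g.val (f p) (push F f (Φ.Efr i) p) v =
      g.val (f p) (push F f (Φ.Efr i) p) (S.trProj p v : TangentSpace 𝓘(ℝ, F) (f p)) := by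
    have := hE.2 _ hdec
    rwa [map_sub, sub_eq_zero] at this
  have h₂ := (Φ.tr_linearIndependent p hp).linearCombination_repr
    ⟨(S.trProj p v : TangentSpace 𝓘(ℝ, F) (f p)), by
      rw [Φ.tr_span p hp]; exact (S.trProj p v).2⟩
  rw [Finsupp.linearCombination_apply, Finsupp.sum_fintype _ _ (by simp)] at h₂
  rw [h₁, ← h₂, map_sum, Fintype.sum_sum_type]
  simp [hW, Φ.dual p hp, NullFrame.trCoord]

variable [FiniteDimensional ℝ F]

/-! ### The covariant derivative along `f` -/

theorem covAlong_congr
    (cov : CovariantDerivative 𝓘(ℝ, F) F (TangentSpace 𝓘(ℝ, F) : Mb → Type _))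
    {f : M → Mb} {Y Z : FieldAlong F f} {p : M} (h : ∀ᶠ q in 𝓝 p, Y q = Z q)
    (x : TangentSpace 𝓘(ℝ, E) p) : covAlong cov f Y p x = covAlong cov f Z p x := by
  unfold covAlong
  refine Finset.sum_congr rfl fun i _ ↦ ?_
  congr 2
  · exact congr($(mvfderiv_congr_of_eventuallyEq (h.mono fun q hq ↦ by simp only [hq])) x)
  · rw [h.self_of_nhds]

/-- Near `p` the coefficient is a linear coordinate of the fibre part of `Y` in the trivialization
at `f p`, and that fibre part is smooth. -/
theorem SmoothAlongOn.mdifferentiableAt_localFrameCoeff {ι : Type*} [Finite ι]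
    (b : Module.Basis ι ℝ F) {f : M → Mb} {Y : FieldAlong F f} {U : Set M} (hU : IsOpen U)
    (hY : SmoothAlongOn E f Y U) {p : M} (hp : p ∈ U) (i : ι) :
    MDifferentiableAt 𝓘(ℝ, E) 𝓘(ℝ, ℝ) (fun q ↦
      (trivializationAt F (TangentSpace 𝓘(ℝ, F) : Mb → Type _) (f p)).localFrameCoeff
        𝓘(ℝ, F) b i (f q) (Y q)) p := by
  set e := trivializationAt F (TangentSpace 𝓘(ℝ, F) : Mb → Type _) (f p)
  have hpe : f p ∈ e.baseSet := FiberBundle.mem_baseSet_trivializationAt' (f p)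
  have h := (e.contMDiffAt_iff (IM := 𝓘(ℝ, E)) (IB := 𝓘(ℝ, F)) (n := ∞)
    (f := fun q ↦ (⟨f q, Y q⟩ : TangentBundle 𝓘(ℝ, F) Mb)) (x₀ := p)
    (by rw [e.mem_source]; exact hpe)).1 (hY.contMDiffAt (hU.mem_nhds hp))
  have h₁ : MDifferentiableAt 𝓘(ℝ, E) 𝓘(ℝ, F)
      (fun q ↦ (e (⟨f q, Y q⟩ : TangentBundle 𝓘(ℝ, F) Mb)).2) p :=
    h.2.mdifferentiableAt (by simp)
  let φ : F →L[ℝ] ℝ := LinearMap.toContinuousLinearMap (b.coord i)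
  have h₂ : MDifferentiableAt 𝓘(ℝ, E) 𝓘(ℝ, ℝ)
      (fun q ↦ φ (e (⟨f q, Y q⟩ : TangentBundle 𝓘(ℝ, F) Mb)).2) p :=
    MDifferentiableAt.comp p (φ.mdifferentiableAt) h₁
  refine h₂.congr_of_eventuallyEq ?_
  have hc : ContinuousAt f p := h.1.continuousAt
  filter_upwards [hc (e.open_baseSet.mem_nhds hpe)] with q hq
  classical
  -- The coefficient formula takes a section over `Mb`, while `Y` lives over `M`. As only the value
  -- at `f q` matters, the single vector `Y q` is extended by zero.
  have := e.localFrameCoeff_eq_coeff (I := 𝓘(ℝ, F)) (b := b) hq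
    (s := fun y ↦ if hy : y = f q then hy ▸ Y q else 0) (i := i)
  simpa [φ] using this

/-- `hcov.metric` concerns fields on `Mb`, so it is applied to a local frame `s` there. Expanding
`g(Y, Z) = ∑ y_i z_j g(s_i, s_j) ∘ f`, the product rule differentiates the coefficients on `M` and
the chain rule carries the identity for the Gram functions `g(s_i, s_j)` over to `f`. No extension
of `Y` or `Z` to `Mb` is needed. -/
theorem IsLeviCivita.mvfderiv_covAlong {g : SemiRiemannianMetric F Mb}
    {cov : CovariantDerivative 𝓘(ℝ, F) F (TangentSpace 𝓘(ℝ, F) : Mb → Type _)}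
    (hcov : IsLeviCivita g cov) {f : M → Mb} {U : Set M} (hU : IsOpen U)
    {Y Z : FieldAlong F f} {p : M} (hp : p ∈ U) (hf : MDifferentiableAt 𝓘(ℝ, E) 𝓘(ℝ, F) f p)
    (hY : SmoothAlongOn E f Y U) (hZ : SmoothAlongOn E f Z U) (x : TangentSpace 𝓘(ℝ, E) p) :
    mvfderiv 𝓘(ℝ, E) (fun q ↦ g.val (f q) (Y q) (Z q)) p x
      = g.val (f p) (covAlong cov f Y p x) (Z p) + g.val (f p) (Y p) (covAlong cov f Z p x) := by
  set e := trivializationAt F (TangentSpace 𝓘(ℝ, F) : Mb → Type _) (f p)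
  have hpe : f p ∈ e.baseSet := FiberBundle.mem_baseSet_trivializationAt' (f p)
  set b := Module.finBasis ℝ F
  set y := fun i q ↦ e.localFrameCoeff 𝓘(ℝ, F) b i (f q) (Y q) with hy
  set z := fun i q ↦ e.localFrameCoeff 𝓘(ℝ, F) b i (f q) (Z q) with hz
  set s := e.localFrame b
  have hyd (i) : MDifferentiableAt 𝓘(ℝ, E) 𝓘(ℝ, ℝ) (y i) p :=
    hY.mdifferentiableAt_localFrameCoeff b hU hp i
  have hzd (i) : MDifferentiableAt 𝓘(ℝ, E) 𝓘(ℝ, ℝ) (z i) p :=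
    hZ.mdifferentiableAt_localFrameCoeff b hU hp i
  have hsum (W : FieldAlong F f) {q : M} (hq : f q ∈ e.baseSet) :
      W q = ∑ i, e.localFrameCoeff 𝓘(ℝ, F) b i (f q) (W q) • s i (f q) := by
    classical
    -- Extension by zero again turns the single vector `W q` into a section over `Mb`.
    have := e.eq_sum_localFrameCoeff_smul (I := 𝓘(ℝ, F)) (b := b) hq
      (s := fun y ↦ if hy : y = f q then hy ▸ W q else 0)
    simpa using this
  have hsd (i) : MDiffAt (T% (s i)) (f p) :=
    (contMDiffAt_localFrame_of_mem (I := 𝓘(ℝ, F)) 1 e b i hpe).mdifferentiableAt one_ne_zero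
  set G := fun i j (v : Mb) ↦ g.val v (s i v) (s j v) with hG
  have hGd (i j) : MDifferentiableAt 𝓘(ℝ, F) 𝓘(ℝ, ℝ) (G i j) (f p) := by
    have h := MDifferentiableAt.clm_bundle_apply₂ (E₃ := Bundle.Trivial Mb ℝ) (F₃ := ℝ)
      (b := fun v : Mb ↦ v) (g.contMDiff.mdifferentiableAt (x := f p) (by simp)) (hsd i) (hsd j)
    simpa using (mdifferentiableAt_section (IB := 𝓘(ℝ, F)) (F := ℝ) (E := Bundle.Trivial Mb ℝ)
      (G i j)).1 h
  have hGf (i j) : MDifferentiableAt 𝓘(ℝ, E) 𝓘(ℝ, ℝ) (fun q ↦ G i j (f q)) p :=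
    (hGd i j).comp p hf
  have hbil (v : Mb) (A B : Fin (Module.finrank ℝ F) → TangentSpace 𝓘(ℝ, F) v) :
      g.val v (∑ i, A i) (∑ j, B j) = ∑ i, ∑ j, g.val v (A i) (B j) := by
    simp only [map_sum, sum_apply]
    exact Finset.sum_comm
  have hev : ∀ᶠ q in 𝓝 p, g.val (f q) (Y q) (Z q) = ∑ i, ∑ j, y i q * (z j q * G i j (f q)) := by
    filter_upwards [hf.continuousAt (e.open_baseSet.mem_nhds hpe)] with q hq
    conv_lhs => rw [hsum Y hq, hsum Z hq, hbil]
    simp [hy, hz, hG, mul_left_comm]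
  have hd (i j) : MDifferentiableAt 𝓘(ℝ, E) 𝓘(ℝ, ℝ)
      (fun q ↦ y i q * (z j q * G i j (f q))) p := (hyd i).mul ((hzd j).mul (hGf i j))
  have key : mvfderiv 𝓘(ℝ, E) (fun q ↦ g.val (f q) (Y q) (Z q)) p x =
      ∑ i, ∑ j, (mvfderiv 𝓘(ℝ, E) (y i) p x * (z j p * G i j (f p)) +
        y i p * (mvfderiv 𝓘(ℝ, E) (z j) p x * G i j (f p) +
          z j p * (g.val (f p) (cov (s i) (f p) (mfderiv 𝓘(ℝ, E) 𝓘(ℝ, F) f p x)) (s j (f p)) +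
            g.val (f p) (s i (f p)) (cov (s j) (f p) (mfderiv 𝓘(ℝ, E) 𝓘(ℝ, F) f p x))))) := by
    rw [mvfderiv_congr_of_eventuallyEq hev,
      (mvfderiv_finset_sum _ fun i _ ↦ (mvfderiv_finset_sum _ fun j _ ↦ hd i j).1).2, sum_apply]
    refine Finset.sum_congr rfl fun i _ ↦ ?_
    rw [(mvfderiv_finset_sum _ fun j _ ↦ hd i j).2, sum_apply]
    refine Finset.sum_congr rfl fun j _ ↦ ?_
    have h : mvfderiv 𝓘(ℝ, E) (fun q ↦ G i j (f q)) p x = _ :=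
      mvfderiv_comp_apply p (hGd i j) hf x
    rw [mvfderiv_mul_mul (hyd i) (hzd j) (hGf i j), h,
      hcov.metric (s i) (s j) (f p) (hsd i) (hsd j)]
  -- Definitional, because `e` and `b` are the very trivialization and basis used in `covAlong`.
  have hYc : covAlong cov f Y p x = ∑ i, (mvfderiv 𝓘(ℝ, E) (y i) p x • s i (f p) +
      y i p • cov (s i) (f p) (mfderiv 𝓘(ℝ, E) 𝓘(ℝ, F) f p x)) := rfl
  have hZc : covAlong cov f Z p x = ∑ i, (mvfderiv 𝓘(ℝ, E) (z i) p x • s i (f p) +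
      z i p • cov (s i) (f p) (mfderiv 𝓘(ℝ, E) 𝓘(ℝ, F) f p x)) := rfl
  rw [key, hYc, hZc, hsum Y hpe, hsum Z hpe]
  simp only [hbil, ← Finset.sum_add_distrib]
  refine Finset.sum_congr rfl fun i _ ↦ Finset.sum_congr rfl fun j _ ↦ ?_
  simp only [map_add, map_smul, add_apply, smul_apply, smul_eq_mul, hy, hz, hG]
  ring

end

end NullGeometry

/-! ### The vanishing of `h_k^l(X, E_i)` and `φ_{αi}(X)` -/

theorem mainTheorem7
    {E : Type*} [NormedAddCommGroup E] [NormedSpace ℝ E] [FiniteDimensional ℝ E]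
    {F : Type*} [NormedAddCommGroup F] [NormedSpace ℝ F] [FiniteDimensional ℝ F]
    {M : Type*} [TopologicalSpace M] [T2Space M] [ChartedSpace E M] [IsManifold 𝓘(ℝ, E) ∞ M]
    {Mb : Type*} [TopologicalSpace Mb] [T2Space Mb] [ChartedSpace F Mb]
    [IsManifold 𝓘(ℝ, F) ∞ Mb]
    (g : NullGeometry.SemiRiemannianMetric F Mb)
    (cov : CovariantDerivative 𝓘(ℝ, F) F (TangentSpace 𝓘(ℝ, F) : Mb → Type _))
    (hcov : NullGeometry.IsLeviCivita g cov)
    (C : NullGeometry.AlmostContactMetricStructure g)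
    (hC : C.IsNearlyCosymplectic cov)
    (f : M → Mb)
    (S : NullGeometry.NullSubmanifold E g f)
    (Q : NullGeometry.QGCRStructure S C)
    (hproper : Q.IsProper)
    (hascreen : S.IsAscreen C)
    (hmixed : Q.IsMixedTotallyGeodesic cov)
    (U : Set M) (hU : IsOpen U) (r s : ℕ) (Φ : NullGeometry.NullFrame S U r s)
    (X : Π p : M, TangentSpace 𝓘(ℝ, E) p)
    (hX : NullGeometry.IsTangentSection f Q.D U X)
    (i : Fin r) (hi : NullGeometry.IsTangentSection f Q.D₂ U (Φ.Efr i)) :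
    ∀ (p : M) (hp : p ∈ U),
      (∀ k : Fin r, Φ.hl cov k p hp (X p) (Φ.Efr i) = 0) ∧
      (∀ α : Fin s, Φ.varphi cov α i p hp (X p) = 0) := by
  intro p hp
  have hzero : S.trProj p
      (NullGeometry.covAlong cov f (NullGeometry.push F f (Φ.Efr i)) p (X p)) = 0 := by
    obtain ⟨X', hX', hXX'⟩ := hX.exists_extension hU hp
    have hi' : NullGeometry.IsTangentSection f Q.Dhat U (Φ.Efr i) :=
      ⟨hi.1, fun q hq ↦ Submodule.mem_sup_left (Submodule.mem_sup_left (hi.2 q hq))⟩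
    obtain ⟨Y, hY, hYE⟩ := hi'.exists_extension hU hp
    have h := hmixed X' Y hX' hY p
    -- The direction `X` enters only through its value at `p`, whereas the differentiated field
    -- `E_i` has to be replaced on a neighbourhood.
    rw [hXX'.self_of_nhds] at h
    rwa [NullGeometry.covAlong_congr cov (Z := NullGeometry.push F f Y)
      (hYE.mono fun q hq ↦ by simp [NullGeometry.push, hq])]
  refine ⟨fun k ↦ congrFun (Φ.trCoord_eq_zero hp hzero) _, fun α ↦ ?_⟩
  have hWperp (q : M) (hq : q ∈ U) (w) (hw : w ∈ NullGeometry.tangentSub (E := E) f q) :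
      g.val (f q) (Φ.Wfr α q) w = 0 := by
    have h : Φ.Wfr α q ∈ NullGeometry.perp g f (NullGeometry.tangentSub (E := E) f) q := by
      rw [← S.screenTr_sup q]
      exact Submodule.mem_sup_right ((Φ.W_section α).2 q hq)
    exact h w hw
  have hprod : ∀ᶠ q in 𝓝 p, g.val (f q) (NullGeometry.push F f (Φ.Efr i) q) (Φ.Wfr α q) = 0 := by
    filter_upwards [hU.mem_nhds hp] with q hq
    rw [g.symm]
    exact hWperp q hq _ ((Φ.E_section i).2 q hq).1
  have hcompat := hcov.mvfderiv_covAlong hU hp (S.smooth.mdifferentiableAt (by simp))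
    (NullGeometry.smoothAlongOn_push S.smooth (Φ.E_section i).1) (Φ.W_section α).1 (X p)
  have hleft : mvfderiv 𝓘(ℝ, E)
      (fun q ↦ g.val (f q) (NullGeometry.push F f (Φ.Efr i) q) (Φ.Wfr α q)) p = 0 := by
    rw [NullGeometry.mvfderiv_congr_of_eventuallyEq (b := fun _ ↦ (0 : ℝ)) hprod, mvfderiv_const]
  -- The kernel of the projection onto `tr(TM)` is `TM`, so `h(X, E_i) = 0` says that `∇_X E_i` is
  -- tangent.
  have htan : NullGeometry.covAlong cov f (NullGeometry.push F f (Φ.Efr i)) p (X p) ∈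
      NullGeometry.tangentSub (E := E) f p :=
    (Submodule.projectionOnto_apply_eq_zero_iff (S.isCompl_tr p).symm).1 hzero
  rw [hleft, g.symm, hWperp p hp _ htan, zero_add] at hcompat
  exact (Φ.trCoord_inl hp _ i).trans hcompat.symm
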